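/- Let $|\cdot|$ be a norm on $\mathbb R^n$, and also the induced operator norm on $n\times n$ matrices. Let $J\subset\mathbb Z$ be an interval of the form $[a,\infty)$, $(-\infty,b]$ or $(-\infty,\infty)$, and let $J'=\{k\in J: k+1\in J\}$. For $n\times n$ matrices $A(k)$, $k\in J'$ (not assumed invertible or bounded), let $\Phi(k,m)=A(k-1)\cdots A(m)$ for $k\ge m$ in $J$ (so $\Phi(m,m)=I$). The system $x(k+1)=A(k)x(k)$ has an exponential dichotomy on $J$ with projection $P(k)$, rank $r$, constant $K\ge1$ and exponent $\alpha>0$ if $P(k)$, $k\in J$, are projections of constant rank $r$ such that: * $\Phi(k,m)P(m)=P(k)\Phi(k,m)$ for $k\ge m$ in $J$; * for each $k\in J'$, $A(k)$ maps the nullspace $\mathcal N P(k)$ bijectively onto $\mathcal N P(k+1)$; * for $k\ge m$ in $J$, $$|\Phi(k,m)P(m)|\le Ke^{-\alpha(k-m)},\qquad |\Phi(m,k)(I-P(k))|\le Ke^{-\alpha(k-m)},$$ where $\Phi(m,k)$ is the inverse of $\Phi(k,m):\mathcal N P(m)\to\mathcal N P(k)$. **Theorem.** Suppose that $x(k+1)=A(k)x(k)$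 has an exponential dichotomy on $J$ with projection $P(k)$, rank $r$, constant $K$ and exponent $\alpha$. Let $B(k)$, $k\in J'$, be $n\times n$ matrices with $|B(k)|\le\delta$ for all $k\in J'$, where $$\rho\delta<1,\qquad \rho=K(1-e^{-\alpha})^{-1}(1+e^{-\alpha}).$$ Put $$\begin{aligned} \beta&=-\log\left(\cosh\alpha-\sqrt{\sinh^2\alpha-2K\delta\sinh\alpha}\right),\\ \gamma&=\beta+\log(1+2Ke^{\alpha}\delta\sinh\alpha),\\ D_1&=\left(1-K(1-e^{-(\alpha+\beta)})^{-1}\delta\right)^{-1},\\ D_2&=\left(1-Ke^{\alpha-\gamma}(1-e^{-(\alpha+\gamma)})^{-1}\delta\right)^{-1},\\ L&=K\left(1+K\delta(1-\rho\delta)^{-1}(1-e^{-\alpha})^{-1}\right)\max\{D_1,D_2\}. \end{aligned}$$ Then the perturbed system $x(k+1)=A(k)[I+B(k)]x(k)$ has an exponential dichotomy on $J$ with a projection $Q(k)$ of the same rank $r$, constant $L$ and exponent $\beta$, such that for all $k\in J$ $$|Q(k)-P(k)|\le KL(1-e^{-(\alpha+\beta)})^{-1}(1+e^{-(\alpha+\beta)})\delta.$$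 -/

import Mathlib

/-! Linear difference equations `x(k+1) = A(k) x(k)` on an interval `J` of integers, with values in
`E = ℝⁿ` equipped with an arbitrary norm. Linear operators carry the induced operator norm; in the
ring `E →L[ℝ] E`, multiplication is composition and `1` is the identity. -/

namespace DiffDichotomy

variable {E : Type*} [NormedAddCommGroup E] [NormedSpace ℝ E]

/-- `transitionAux A m j = A(m+j-1) ⋯ A(m+1) A(m)`, a product of `j` factors. -/
def transitionAux (A : ℤ → E →L[ℝ] E) (m : ℤ) : ℕ → E →L[ℝ] E
  | 0 => 1
  | j + 1 => A (m + j) * transitionAux A m j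

/-- The transition operator `Φ(k,m) = A(k-1) ⋯ A(m)`, for `m ≤ k`. -/
def transition (A : ℤ → E →L[ℝ] E) (k m : ℤ) : E →L[ℝ] E :=
  transitionAux A m (k - m).toNat

/-- The index set `J'` on which the equation is imposed: `x(k+1) = A(k) x(k)` relates the values of
`x` at `k ∈ J` and `k + 1 ∈ J`. Thus `J' = J` if `J` is unbounded above, and
`J' = (-∞, b-1]` if `J = (-∞, b]`. -/
def equationDomain (J : Set ℤ) : Set ℤ := {k | k ∈ J ∧ k + 1 ∈ J}

/-- The inverse `Φ(m,k) : N P(k) → N P(m)` of the restriction `Φ(k,m) : N P(m) → N P(k)`,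
given that this restriction is a bijection. -/
noncomputable def nullspaceInverse (A P : ℤ → E →L[ℝ] E) (m k : ℤ)
    (h : Set.BijOn (transition A k m) (P m).ker (P k).ker) :
    (P k).ker ≃ₗ[ℝ] (P m).ker :=
  (LinearEquiv.ofBijective
    ((transition A k m).toLinearMap.restrict (p := (P m).ker) (q := (P k).ker)
      (fun _ hx => h.mapsTo hx))
    ⟨fun x y hxy => Subtype.ext (h.injOn x.2 y.2 (congrArg Subtype.val hxy)),
      fun y => by
        obtain ⟨x, hx, hxy⟩ := h.surjOn y.2
        exact ⟨⟨x, hx⟩, Subtype.ext hxy⟩⟩).symm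

theorem transition_nullspaceInverse (A P : ℤ → E →L[ℝ] E) (m k : ℤ)
    (h : Set.BijOn (transition A k m) (P m).ker (P k).ker) (y : (P k).ker) :
    transition A k m (nullspaceInverse A P m k h y : E) = y :=
  congrArg Subtype.val ((nullspaceInverse A P m k h).symm_apply_apply y)

open Classical in
/-- The operator `Φ(m,k)(I - P(k))` on `E`, for `m ≤ k`, where `Φ(m,k)` is the inverse of
`Φ(k,m) : N P(m) → N P(k)`. The value outside the case in which `P(k)` is a projection and
`Φ(k,m)` is bijective between the nullspaces is irrelevant. -/
noncomputable def backwardOperator [FiniteDimensional ℝ E] (A P : ℤ → E →L[ℝ] E) (m k : ℤ) :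
    E →L[ℝ] E :=
  if h : (P k * P k = P k) ∧ Set.BijOn (transition A k m) (P m).ker (P k).ker then
    LinearMap.toContinuousLinearMap
      ((P m).ker.subtype ∘ₗ (nullspaceInverse A P m k h.2).toLinearMap ∘ₗ
        ((1 - P k : E →L[ℝ] E).toLinearMap.codRestrict (P k).ker (fun x => by
          have := congrArg (fun T : E →L[ℝ] E => T x) h.1
          simp only [mul_apply_eq_comp] at this
          simp [this])))
  else 0

/-- The equation `x(k+1) = A(k) x(k)` has an exponential dichotomy on `J` with projection `P(k)`
of rank `r`, constant `L` and exponent `α`. -/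
structure HasExpDichotomy [FiniteDimensional ℝ E] (J : Set ℤ) (A P : ℤ → E →L[ℝ] E)
    (r : ℕ) (L α : ℝ) : Prop where
  one_le : 1 ≤ L
  pos : 0 < α
  /-- each `P(k)` is a projection -/
  proj : ∀ k ∈ J, P k * P k = P k
  /-- the rank is constant -/
  rank : ∀ k ∈ J, Module.finrank ℝ (P k).range = r
  /-- invariance -/
  invariant : ∀ m ∈ J, ∀ k ∈ J, m ≤ k → transition A k m * P m = P k * transition A k m
  /-- `A(k) : N P(k) → N P(k+1)` is invertible -/
  bijOn : ∀ k ∈ equationDomain J, Set.BijOn (A k) (P k).ker (P (k + 1)).ker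
  /-- decay on the ranges, forward in time -/
  stable : ∀ m ∈ J, ∀ k ∈ J, m ≤ k →
    ‖transition A k m * P m‖ ≤ L * Real.exp (-α * ((k : ℝ) - (m : ℝ)))
  /-- decay on the nullspaces, backward in time -/
  unstable : ∀ m ∈ J, ∀ k ∈ J, m ≤ k →
    ‖backwardOperator A P m k‖ ≤ L * Real.exp (-α * ((k : ℝ) - (m : ℝ)))

/-- `Φ(k,m)` is a bijection between the nullspaces as soon as all the `A(j)` are. -/
theorem transition_bijOn {J : Set ℤ} [hJ : J.OrdConnected] {A P : ℤ → E →L[ℝ] E}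
    (hb : ∀ k ∈ equationDomain J, Set.BijOn (A k) (P k).ker (P (k + 1)).ker)
    {m k : ℤ} (hm : m ∈ J) (hk : k ∈ J) (hmk : m ≤ k) :
    Set.BijOn (transition A k m) (P m).ker (P k).ker := by
  have key : ∀ j : ℕ, m + j ≤ k →
      Set.BijOn (transitionAux A m j) (P m).ker (P (m + j)).ker := by
    intro j
    induction j with
    | zero => intro _; simpa [transitionAux] using Set.bijOn_id _
    | succ j ih =>
      intro hj
      push_cast at hj
      have h1 := ih (by omega)
      have h2 := hb (m + j) ⟨hJ.out hm hk ⟨by omega, by omega⟩,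
        hJ.out hm hk ⟨by omega, by omega⟩⟩
      have h3 := h2.comp h1
      push_cast
      rw [← add_assoc]
      exact h3
  have := key (k - m).toNat (by omega)
  rw [show m + ((k - m).toNat : ℤ) = k by omega] at this
  exact this

/-- The defining properties of `Φ(m,k)(I - P(k))`: its values lie in `N P(m)`, and `Φ(k,m)` maps
`Φ(m,k)(I - P(k)) x` to `(I - P(k)) x`. -/
theorem backwardOperator_spec [FiniteDimensional ℝ E] {A P : ℤ → E →L[ℝ] E} {m k : ℤ}
    (hP : P k * P k = P k) (h : Set.BijOn (transition A k m) (P m).ker (P k).ker) (x : E) :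
    P m (backwardOperator A P m k x) = 0 ∧
      transition A k m (backwardOperator A P m k x) = x - P k x := by
  rw [backwardOperator, dif_pos ⟨hP, h⟩]
  exact ⟨((nullspaceInverse A P m k h) _).2, transition_nullspaceInverse A P m k h _⟩

/-! The explicit constants. -/

/-- `ρ = K (1 - e^{-α})⁻¹ (1 + e^{-α})` -/
noncomputable def rho (K α : ℝ) : ℝ := K * (1 - Real.exp (-α))⁻¹ * (1 + Real.exp (-α))

/-- `β = -log (cosh α - √(sinh² α - 2 K δ sinh α))` -/
noncomputable def beta (K α δ : ℝ) : ℝ :=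
  -Real.log (Real.cosh α - Real.sqrt (Real.sinh α ^ 2 - 2 * K * δ * Real.sinh α))

/-- `γ = β + log (1 + 2 K e^α δ sinh α)` -/
noncomputable def gamma (K α δ : ℝ) : ℝ :=
  beta K α δ + Real.log (1 + 2 * K * Real.exp α * δ * Real.sinh α)

/-- `D₁ = (1 - K (1 - e^{-(α+β)})⁻¹ δ)⁻¹` -/
noncomputable def D₁ (K α δ : ℝ) : ℝ :=
  (1 - K * (1 - Real.exp (-(α + beta K α δ)))⁻¹ * δ)⁻¹

/-- `D₂ = (1 - K e^{α-γ} (1 - e^{-(α+γ)})⁻¹ δ)⁻¹` -/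
noncomputable def D₂ (K α δ : ℝ) : ℝ :=
  (1 - K * Real.exp (α - gamma K α δ) * (1 - Real.exp (-(α + gamma K α δ)))⁻¹ * δ)⁻¹

/-- `L = K (1 + K δ (1 - ρδ)⁻¹ (1 - e^{-α})⁻¹) max {D₁, D₂}` -/
noncomputable def newConstant (K α δ : ℝ) : ℝ :=
  K * (1 + K * δ * (1 - rho K α * δ)⁻¹ * (1 - Real.exp (-α))⁻¹) * max (D₁ K α δ) (D₂ K α δ)

end DiffDichotomy

namespace DiffDichotomy

/-! ### The two-sided exponential kernel -/

/-- The kernel `e^{-α|k|}` on `ℤ`. -/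
noncomputable def expKernel (α : ℝ) (k : ℤ) : ℝ := Real.exp (-α * |(k : ℝ)|)

theorem expKernel_pos (α : ℝ) (k : ℤ) : 0 < expKernel α k := Real.exp_pos _

theorem expKernel_of_nonneg (α : ℝ) {k : ℤ} (hk : 0 ≤ k) :
    expKernel α k = Real.exp (-α * (k : ℝ)) := by
  rw [expKernel, abs_of_nonneg (by exact_mod_cast hk)]

theorem expKernel_of_nonpos (α : ℝ) {k : ℤ} (hk : k ≤ 0) :
    expKernel α k = Real.exp (α * (k : ℝ)) := by
  rw [expKernel, abs_of_nonpos (by exact_mod_cast hk)]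
  congr 1
  ring

theorem expKernel_neg (α : ℝ) (k : ℤ) : expKernel α (-k) = expKernel α k := by
  simp [expKernel]

theorem expKernel_sub_comm (α : ℝ) (k j : ℤ) : expKernel α (k - j) = expKernel α (j - k) := by
  rw [← expKernel_neg, neg_sub]

theorem expKernel_zero (α : ℝ) : expKernel α 0 = 1 := by simp [expKernel]

theorem expKernel_le_one {α : ℝ} (hα : 0 ≤ α) (k : ℤ) : expKernel α k ≤ 1 := by
  rw [expKernel, Real.exp_le_one_iff]
  nlinarith [mul_nonneg hα (abs_nonneg (k : ℝ))]

theorem expKernel_anti {α β : ℝ} (h : β ≤ α) (k : ℤ) : expKernel α k ≤ expKernel β k := by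
  rw [expKernel, expKernel, Real.exp_le_exp]
  nlinarith [mul_le_mul_of_nonneg_right h (abs_nonneg (k : ℝ))]

theorem expKernel_mul (α β : ℝ) (k : ℤ) :
    expKernel α k * expKernel β k = expKernel (α + β) k := by
  rw [expKernel, expKernel, expKernel, ← Real.exp_add]
  congr 1
  ring

theorem hasSum_expKernel {α : ℝ} (hα : 0 < α) :
    HasSum (expKernel α) ((1 - Real.exp (-α))⁻¹ * (1 + Real.exp (-α))) := by
  have hq : Real.exp (-α) < 1 := by rw [Real.exp_lt_one_iff]; linarith
  have h := hasSum_geometric_of_lt_one (Real.exp_pos (-α)).le hq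
  have h1 : HasSum (fun n : ℕ => expKernel α n) (1 - Real.exp (-α))⁻¹ := by
    convert h using 2 with n
    rw [expKernel_of_nonneg _ (by positivity), ← Real.exp_nat_mul]
    congr 1
    push_cast
    ring
  have h2 : HasSum (fun n : ℕ => expKernel α (-(n + 1 : ℤ)))
      ((1 - Real.exp (-α))⁻¹ * Real.exp (-α)) := by
    have e : (fun n : ℕ => expKernel α (-(n + 1 : ℤ))) =
        fun n : ℕ => Real.exp (-α) ^ n * Real.exp (-α) := funext fun n => ?_
    · rw [e]
      exact h.mul_right _
    rw [expKernel_neg, expKernel_of_nonneg _ (by positivity), ← pow_succ, ← Real.exp_nat_mul]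
    congr 1
    push_cast
    ring
  have := HasSum.of_nat_of_neg_add_one h1 h2
  rwa [← mul_one_add] at this

theorem hasSum_expKernel_sub {α : ℝ} (hα : 0 < α) (k : ℤ) :
    HasSum (fun j => expKernel α (k - j)) ((1 - Real.exp (-α))⁻¹ * (1 + Real.exp (-α))) :=
  ((Equiv.subLeft k).hasSum_iff (f := expKernel α)).2 (hasSum_expKernel hα)

theorem summable_expKernel_mul {α : ℝ} (hα : 0 < α) {v : ℤ → ℝ} {M : ℝ} (hv : ∀ j, |v j| ≤ M)
    (k : ℤ) : Summable fun j => expKernel α (k - j) * v j := by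
  refine Summable.of_norm_bounded ((hasSum_expKernel_sub hα k).summable.mul_right M) fun j => ?_
  rw [Real.norm_eq_abs, abs_mul, abs_of_pos (expKernel_pos _ _)]
  exact mul_le_mul_of_nonneg_left (hv j) (expKernel_pos _ _).le

theorem expKernel_second_difference (α : ℝ) (k : ℤ) :
    2 * Real.cosh α * expKernel α k - expKernel α (k + 1) - expKernel α (k - 1) =
      if k = 0 then 2 * Real.sinh α else 0 := by
  rcases lt_trichotomy k 0 with hk | rfl | hk
  · rw [if_neg hk.ne, expKernel_of_nonpos _ hk.le, expKernel_of_nonpos _ (by omega),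
      expKernel_of_nonpos _ (by omega), Real.cosh_eq]
    push_cast
    rw [mul_add, mul_sub, mul_one, sub_eq_add_neg (α * (k : ℝ)) α, Real.exp_add, Real.exp_add]
    ring
  · rw [if_pos rfl, expKernel_zero, expKernel_of_nonneg _ (by omega),
      expKernel_of_nonpos _ (by omega), Real.cosh_eq, Real.sinh_eq]
    push_cast
    rw [mul_one, mul_neg_one]
    ring_nf
  · rw [if_neg hk.ne', expKernel_of_nonneg _ hk.le, expKernel_of_nonneg _ (by omega),
      expKernel_of_nonneg _ (by omega), Real.cosh_eq]
    push_cast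
    rw [mul_add, mul_sub, mul_one, sub_neg_eq_add, Real.exp_add, Real.exp_add]
    ring

/-- `(2 sinh α)⁻¹ e^{-α|k|}` is the Green's function of `v ↦ 2 cosh α v(k) - v(k+1) - v(k-1)`. -/
theorem tsum_expKernel_second_difference {α : ℝ} (hα : 0 < α) {v : ℤ → ℝ} {M : ℝ}
    (hv : ∀ j, |v j| ≤ M) (k : ℤ) :
    ∑' j, expKernel α (k - j) * (2 * Real.cosh α * v j - v (j + 1) - v (j - 1)) =
      2 * Real.sinh α * v k := by
  have h0 := (summable_expKernel_mul hα hv k).hasSum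
  have hs (a : ℤ) : HasSum (fun j => expKernel α (k - j) * v (j + a))
      (∑' j, expKernel α (k + a - j) * v j) := by
    have := (Equiv.addRight a).hasSum_iff.2 (summable_expKernel_mul hα hv (k + a)).hasSum
    convert this using 2 with j
    simp
  have h1 := ((h0.mul_left (2 * Real.cosh α)).sub (hs 1)).sub (hs (-1))
  have h2 := ((h0.mul_left (2 * Real.cosh α)).sub
    (summable_expKernel_mul hα hv (k + 1)).hasSum).sub
    (summable_expKernel_mul hα hv (k + -1)).hasSum
  have h3 : (fun j => 2 * Real.cosh α * (expKernel α (k - j) * v j) -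
      expKernel α (k + 1 - j) * v j - expKernel α (k + -1 - j) * v j) =
      fun j => if j = k then 2 * Real.sinh α * v k else 0 := by
    funext j
    have := expKernel_second_difference α (k - j)
    rw [show k + 1 - j = k - j + 1 by ring, show k + -1 - j = k - j - 1 by ring]
    rw [show 2 * Real.cosh α * (expKernel α (k - j) * v j) - expKernel α (k - j + 1) * v j -
      expKernel α (k - j - 1) * v j = (2 * Real.cosh α * expKernel α (k - j) -
      expKernel α (k - j + 1) - expKernel α (k - j - 1)) * v j by ring, this]
    by_cases h : j = k
    · subst h; simp
    · rw [if_neg h, if_neg (by omega), zero_mul]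
  rw [h3] at h2
  have h4 := h2.unique (hasSum_ite_eq k (2 * Real.sinh α * v k))
  rw [← h4, ← h1.tsum_eq]
  refine tsum_congr fun j => ?_
  rw [← sub_eq_add_neg j 1]
  ring

/-- A multiple of `e^{-β|k|}` satisfies the scalar Green's function equation with equality. -/
theorem expKernel_fixed {α β s : ℝ} (hα : 0 < α) (hβ : 0 < β)
    (h : Real.cosh β = Real.cosh α - s * Real.sinh α) (m k : ℤ) :
    expKernel β (k - m) = s * ∑' j, expKernel α (k - j) * expKernel β (j - m) +
      Real.sinh β / Real.sinh α * expKernel α (k - m) := by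
  have hb : ∀ j, |expKernel β (j - m)| ≤ 1 := fun j => by
    rw [abs_of_pos (expKernel_pos _ _)]; exact expKernel_le_one hβ.le _
  have hs : 0 < Real.sinh α := Real.sinh_pos_iff.2 hα
  have h1 := tsum_expKernel_second_difference hα hb k
  have h2 : (fun j => expKernel α (k - j) * (2 * Real.cosh α * expKernel β (j - m) -
      expKernel β (j + 1 - m) - expKernel β (j - 1 - m))) =
      fun j => 2 * s * Real.sinh α * (expKernel α (k - j) * expKernel β (j - m)) +
        if j = m then 2 * Real.sinh β * expKernel α (k - m) else 0 := by
    funext j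
    have := expKernel_second_difference β (j - m)
    rw [show j + 1 - m = j - m + 1 by ring, show j - 1 - m = j - m - 1 by ring]
    rw [show 2 * Real.cosh α * expKernel β (j - m) - expKernel β (j - m + 1) -
      expKernel β (j - m - 1) = 2 * s * Real.sinh α * expKernel β (j - m) +
      (2 * Real.cosh β * expKernel β (j - m) - expKernel β (j - m + 1) -
      expKernel β (j - m - 1)) by rw [h]; ring, this]
    by_cases hj : j = m
    · subst hj; simp only [sub_self, if_true, expKernel_zero]; ring_nf
    · rw [if_neg hj, if_neg (by omega)]; ring
  rw [h2] at h1
  have h3 := (((summable_expKernel_mul hα hb k).hasSum.mul_left (2 * s * Real.sinh α)).add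
    (hasSum_ite_eq m (2 * Real.sinh β * expKernel α (k - m)))).tsum_eq
  rw [h3] at h1
  field_simp
  linarith

/-- Comparison principle for the scalar Green's function inequality. -/
theorem le_of_expKernel_subsolution {α s : ℝ} (hα : 0 < α) (hs : 0 ≤ s)
    (hs1 : s * ((1 - Real.exp (-α))⁻¹ * (1 + Real.exp (-α))) < 1) {w : ℤ → ℝ} {M : ℝ}
    (hM : ∀ k, |w k| ≤ M) (hw : ∀ k, w k ≤ s * ∑' j, expKernel α (k - j) * w j) (k : ℤ) :
    w k ≤ 0 := by
  set σ := (1 - Real.exp (-α))⁻¹ * (1 + Real.exp (-α))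
  have hσ : 0 ≤ σ := (hasSum_expKernel hα).nonneg fun j => (expKernel_pos _ _).le
  have hbdd : BddAbove (Set.range w) := ⟨M, by rintro _ ⟨k, rfl⟩; exact (abs_le.1 (hM k)).2⟩
  set N := max (⨆ k, w k) 0
  have hN : ∀ k, w k ≤ N := fun k => (le_ciSup hbdd k).trans (le_max_left _ _)
  have h1 : ∀ k, w k ≤ s * σ * N := fun k => by
    refine (hw k).trans ?_
    rw [mul_assoc]
    refine mul_le_mul_of_nonneg_left ?_ hs
    exact hasSum_le (fun j => mul_le_mul_of_nonneg_left (hN j) (expKernel_pos _ _).le)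
      (summable_expKernel_mul hα hM k).hasSum ((hasSum_expKernel_sub hα k).mul_right N)
  have h2 : N ≤ s * σ * N :=
    max_le (ciSup_le h1) (mul_nonneg (mul_nonneg hs hσ) (le_max_right _ _))
  have h3 : N ≤ 0 := by
    by_contra! h
    nlinarith
  exact (hN k).trans h3

theorem le_of_expKernel_inequality {α β s K c : ℝ} (hα : 0 < α) (hβ : 0 < β) (hs : 0 ≤ s)
    (hs1 : s * ((1 - Real.exp (-α))⁻¹ * (1 + Real.exp (-α))) < 1)
    (h : Real.cosh β = Real.cosh α - s * Real.sinh α) {u : ℤ → ℝ} {M : ℝ}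
    (hM : ∀ k, |u k| ≤ M) (m : ℤ)
    (hu : ∀ k, u k ≤ K * expKernel α (k - m) * c + s * ∑' j, expKernel α (k - j) * u j) (k : ℤ) :
    u k ≤ K * (Real.sinh α / Real.sinh β) * expKernel β (k - m) * c := by
  set C := K * (Real.sinh α / Real.sinh β) * c
  have hsα : 0 < Real.sinh α := Real.sinh_pos_iff.2 hα
  have hsβ : 0 < Real.sinh β := Real.sinh_pos_iff.2 hβ
  have hb : ∀ j, |expKernel β (j - m)| ≤ 1 := fun j => by
    rw [abs_of_pos (expKernel_pos _ _)]; exact expKernel_le_one hβ.le _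
  have hCb : ∀ j, |C * expKernel β (j - m)| ≤ |C| := fun j => by
    rw [abs_mul]; exact mul_le_of_le_one_right (abs_nonneg _) (hb j)
  have := le_of_expKernel_subsolution (w := fun k => u k - C * expKernel β (k - m)) (M := M + |C|)
    hα hs hs1 (fun k => (abs_sub _ _).trans (add_le_add (hM k) (hCb k))) (fun k => ?_) k
  · rw [show K * (Real.sinh α / Real.sinh β) * expKernel β (k - m) * c =
      C * expKernel β (k - m) by simp only [C]; ring]
    linarith
  · have h1 := (summable_expKernel_mul hα hM k).hasSum
    have h2 := (summable_expKernel_mul hα hb k).hasSum.mul_left C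
    have h3 := (h1.sub h2).tsum_eq
    have h4 : ∑' j, expKernel α (k - j) * (u j - C * expKernel β (j - m)) =
        ∑' j, expKernel α (k - j) * u j -
          C * ∑' j, expKernel α (k - j) * expKernel β (j - m) := by
      rw [← h3]
      exact tsum_congr fun j => by ring
    rw [h4, expKernel_fixed hα hβ h m k]
    have h5 : C * (Real.sinh β / Real.sinh α * expKernel α (k - m)) =
        K * expKernel α (k - m) * c := by
      simp only [C]; field_simp
    have h6 := hu k
    linarith

/-! ### The explicit constants -/

theorem one_le_sq_mul_of_mul_lt_one {s t : ℝ} (hs0 : 0 ≤ s) (ht : 1 ≤ t) (hst : s * t < 1) :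
    1 ≤ (1 + s * (1 - s * t)⁻¹ * ((t + 1) / 2)) ^ 2 * ((1 - s * t) * (1 - s * t⁻¹)) := by
  have ha : 0 < 1 - s * t := by linarith
  have hi1 : t⁻¹ ≤ 1 := inv_le_one_of_one_le₀ ht
  have hi0 : 0 < t⁻¹ := by positivity
  generalize t⁻¹ = i at *
  set W := 1 + s * (1 - s * t)⁻¹ * ((t + 1) / 2) with hW
  have hWa : W * (1 - s * t) = 1 - s * t + s * ((t + 1) / 2) := by
    rw [hW, add_mul, one_mul, mul_right_comm s, mul_assoc (s * _), inv_mul_cancel₀ ha.ne', mul_one]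
  have hsi : s * i ≤ s := mul_le_of_le_one_right hs0 hi1
  have hs : s ≤ s * t := le_mul_of_one_le_right hs0 ht
  have h1 : 1 - s * t + s ≤ (W * (1 - s * t)) ^ 2 := by
    rw [hWa]
    linarith [sq_nonneg (s * (t - 1)), show (1 - s * t + s * ((t + 1) / 2)) ^ 2 =
      1 - s * t + s + (s * (t - 1)) ^ 2 / 4 by ring]
  have h2 : i * (1 - s * t + s) ≤ i * 1 := mul_le_mul_of_nonneg_left (by linarith) hi0.le
  have h3 : 0 ≤ s * (1 - i * (1 - s * t + s)) := mul_nonneg hs0 (by linarith)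
  have h4 := mul_le_mul_of_nonneg_right h1 (show 0 ≤ 1 - s * i by linarith)
  refine le_of_mul_le_mul_right ?_ ha
  linarith [show W ^ 2 * ((1 - s * t) * (1 - s * i)) * (1 - s * t) =
    (W * (1 - s * t)) ^ 2 * (1 - s * i) by ring,
    show (1 - s * t + s) * (1 - s * i) = 1 - s * t + s * (1 - i * (1 - s * t + s)) by ring]

theorem exists_optimal_exponent {K α δ : ℝ} (hK : 1 ≤ K) (hα : 0 < α) (hδ0 : 0 ≤ δ)
    (hδ : rho K α * δ < 1) :
    ∃ b, 0 < b ∧ Real.cosh b = Real.cosh α - K * δ * Real.sinh α ∧ 0 < beta K α δ ∧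
      beta K α δ ≤ b ∧ K * (Real.sinh α / Real.sinh b) ≤ newConstant K α δ ∧
      1 ≤ newConstant K α δ := by
  have hq0 : 0 < Real.exp (-α) := Real.exp_pos _
  have hq1 : Real.exp (-α) < 1 := by rw [Real.exp_lt_one_iff]; linarith
  have hS : 0 < Real.sinh α := Real.sinh_pos_iff.2 hα
  have hC : 1 < Real.cosh α := Real.one_lt_cosh.2 hα.ne'
  have hCS : Real.cosh α ^ 2 = 1 + Real.sinh α ^ 2 := Real.cosh_sq' α
  set s := K * δ with hs
  have hs0 : 0 ≤ s := by positivity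
  set q := Real.exp (-α) with hq
  set t := (1 - q)⁻¹ * (1 + q) with ht
  have h1q : 0 < 1 - q := by linarith
  have ht1 : 1 ≤ t := by
    rw [ht, inv_mul_eq_div, le_div_iff₀ h1q]; linarith
  have hst : s * t < 1 := by
    have : rho K α * δ = s * t := by rw [rho, hs, ht, hq]; ring
    rwa [← this]
  have hCq : Real.cosh α = (q⁻¹ + q) / 2 := by rw [Real.cosh_eq, hq, Real.exp_neg, inv_inv]
  have hSq : Real.sinh α = (q⁻¹ - q) / 2 := by rw [Real.sinh_eq, hq, Real.exp_neg, inv_inv]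
  have hCt : 2 * Real.cosh α = (t + t⁻¹) * Real.sinh α := by
    rw [hCq, hSq, ht]
    have : (1 + q) ≠ 0 := by positivity
    have := h1q.ne'
    field_simp
    ring
  have hC1 : Real.cosh α - 1 = t⁻¹ * Real.sinh α := by
    rw [hCq, hSq, ht]
    have : (1 + q) ≠ 0 := by positivity
    have := h1q.ne'
    field_simp
    ring
  have hstinv : s < t⁻¹ := by
    rw [inv_eq_one_div, lt_div_iff₀ (by linarith)]
    exact hst
  have hsS : s * Real.sinh α < Real.cosh α - 1 := by
    rw [hC1]
    exact mul_lt_mul_of_pos_right hstinv hS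
  have hc1 : 1 < Real.cosh α - s * Real.sinh α := by linarith
  set b := Real.arcosh (Real.cosh α - s * Real.sinh α) with hb
  have hb0 : 0 < b := Real.arcosh_pos hc1
  have hcb : Real.cosh b = Real.cosh α - s * Real.sinh α := Real.cosh_arcosh hc1.le
  have hsb : 0 < Real.sinh b := Real.sinh_pos_iff.2 hb0
  set D := Real.sinh α ^ 2 - 2 * K * δ * Real.sinh α with hD
  have hD' : D = Real.sinh α ^ 2 - 2 * (s * Real.sinh α) := by rw [hD, hs]; ring
  have hsqrt_lt : Real.sqrt D < Real.cosh α := by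
    rw [Real.sqrt_lt' (by linarith)]
    linarith [mul_nonneg hs0 hS.le]
  have hlt_sqrt : Real.cosh α - 1 < Real.sqrt D := by
    apply Real.lt_sqrt_of_sq_lt
    linarith [show (Real.cosh α - 1) ^ 2 = Real.cosh α ^ 2 - 2 * Real.cosh α + 1 by ring]
  have hbeta0 : 0 < beta K α δ := by
    rw [beta, neg_pos]
    exact Real.log_neg (by linarith) (by linarith)
  have hbetab : beta K α δ ≤ b := by
    rw [beta, neg_le, Real.le_log_iff_exp_le (by linarith)]
    have hμ0 : 0 < Real.exp (-b) := Real.exp_pos _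
    have hμ1 : Real.exp (-b) < 1 := by rw [Real.exp_lt_one_iff]; linarith
    have hμ : 2 * Real.cosh b * Real.exp (-b) = 1 + Real.exp (-b) ^ 2 := by
      rw [Real.cosh_eq]
      have : Real.exp b * Real.exp (-b) = 1 := by rw [← Real.exp_add]; simp
      linear_combination this
    have : Real.sqrt D ≤ Real.cosh α - Real.exp (-b) := by
      rw [Real.sqrt_le_iff]
      refine ⟨by linarith, ?_⟩
      rw [hcb] at hμ
      linarith [mul_nonneg (mul_nonneg hs0 hS.le) (sub_nonneg.2 hμ1.le),
        show (Real.cosh α - Real.exp (-b)) ^ 2 = Real.cosh α ^ 2 -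
          2 * (Real.cosh α - s * Real.sinh α) * Real.exp (-b) + Real.exp (-b) ^ 2 -
          2 * (s * Real.sinh α) + 2 * (s * Real.sinh α * (1 - Real.exp (-b))) by ring]
    linarith
  have hp : Real.exp (-(α + beta K α δ)) ≤ q := Real.exp_le_exp.2 (by linarith)
  have hsq : s < 1 - q := by
    refine hstinv.trans_le ?_
    rw [ht, mul_inv, inv_inv]
    exact mul_le_of_le_one_right h1q.le (inv_le_one_of_one_le₀ (by linarith))
  have hD1 : 1 ≤ D₁ K α δ := by
    have e : K * (1 - Real.exp (-(α + beta K α δ)))⁻¹ * δ =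
        s / (1 - Real.exp (-(α + beta K α δ))) := by rw [hs]; ring
    rw [D₁, e]
    have h1 : s / (1 - Real.exp (-(α + beta K α δ))) < 1 := by
      rw [div_lt_one (by linarith)]; linarith
    have h2 : 0 ≤ s / (1 - Real.exp (-(α + beta K α δ))) := div_nonneg hs0 (by linarith)
    exact (one_le_inv₀ (by linarith)).2 (by linarith)
  set W := 1 + K * δ * (1 - rho K α * δ)⁻¹ * (1 - Real.exp (-α))⁻¹ with hW
  have hr : rho K α * δ = s * t := by rw [rho, hs, ht, hq]; ring
  have h1W : 1 ≤ W := by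
    rw [hW, hr]
    have : 0 ≤ K * δ * (1 - s * t)⁻¹ * (1 - Real.exp (-α))⁻¹ :=
      mul_nonneg (mul_nonneg hs0 (inv_nonneg.2 (by linarith))) (inv_nonneg.2 h1q.le)
    linarith
  have hmax : 1 ≤ max (D₁ K α δ) (D₂ K α δ) := hD1.trans (le_max_left _ _)
  have hKW : K * W ≤ newConstant K α δ :=
    le_mul_of_one_le_right (mul_nonneg (by linarith) (by linarith)) hmax
  have hratio : Real.sinh α / Real.sinh b ≤ W := by
    have hsb2 : Real.sinh b ^ 2 = Real.sinh α ^ 2 * ((1 - s * t) * (1 - s * t⁻¹)) := by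
      rw [Real.sinh_sq, hcb]
      have htt : t * t⁻¹ = 1 := mul_inv_cancel₀ (by linarith)
      linear_combination hCS - s * Real.sinh α * hCt + (- s ^ 2 * Real.sinh α ^ 2) * htt
    have e : (1 - q)⁻¹ = (t + 1) / 2 := by
      have := h1q.ne'
      rw [ht]; field_simp; ring
    have key := one_le_sq_mul_of_mul_lt_one hs0 ht1 hst
    rw [← e, ← hr] at key
    rw [div_le_iff₀ hsb]
    refine le_of_sq_le_sq ?_ (by positivity)
    rw [mul_pow, hsb2, ← hr, mul_left_comm]
    exact le_mul_of_one_le_right (sq_nonneg _) key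
  refine ⟨b, hb0, hcb, hbeta0, hbetab, ?_, ?_⟩
  · exact (mul_le_mul_of_nonneg_left hratio (by linarith)).trans hKW
  · exact (one_le_mul_of_one_le_of_one_le hK h1W).trans hKW


/-! ### Dichotomies on `ℤ` and their Green's functions -/

theorem summable_expKernel_mul_norm {E : Type*} [NormedAddCommGroup E] {α : ℝ} {f : ℤ → E}
    {M : ℝ} (hα : 0 < α) (hf : ∀ j, ‖f j‖ ≤ M) (k : ℤ) :
    Summable fun j => expKernel α (k - j) * ‖f j‖ :=
  summable_expKernel_mul hα (v := fun j => ‖f j‖) (fun j => by rw [abs_norm]; exact hf j) k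

section Green

variable {E : Type*} [NormedAddCommGroup E] [NormedSpace ℝ E]

/-- An exponential dichotomy on `ℤ`, described by the one-step relations between the operators
`S k m = Φ(k,m)P(m)` and `U m k = Φ(m,k)(I - P(k))`, `m ≤ k`. -/
structure IsIntDichotomy (A P : ℤ → E →L[ℝ] E) (S U : ℤ → ℤ → E →L[ℝ] E) (K α : ℝ) : Prop where
  proj : ∀ k, P k * P k = P k
  comm : ∀ k, A k * P k = P (k + 1) * A k
  stable_self : ∀ m, S m m = P m
  stable_succ : ∀ m k, m ≤ k → A k * S k m = S (k + 1) m
  unstable_self : ∀ m, U m m = 1 - P m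
  unstable_succ : ∀ k m, k < m → A k * U k m = U (k + 1) m
  unstable_mul : ∀ m k, m ≤ k → U m (k + 1) * A k = U m k
  norm_stable_le : ∀ m k, m ≤ k → ‖S k m‖ ≤ K * expKernel α (k - m)
  norm_unstable_le : ∀ m k, m ≤ k → ‖U m k‖ ≤ K * expKernel α (k - m)

/-- The Green's function of `x(k+1) = A(k)(x(k) + f(k))`. -/
def green (S U : ℤ → ℤ → E →L[ℝ] E) (k j : ℤ) : E →L[ℝ] E :=
  if j < k then S k j else -U k j

/-- The bounded solution of `x(k+1) = A(k)(x(k) + f(k))`. -/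
noncomputable def greenSum (S U : ℤ → ℤ → E →L[ℝ] E) (f : ℤ → E) (k : ℤ) : E :=
  ∑' j, green S U k j (f j)

namespace IsIntDichotomy

variable {A P B : ℤ → E →L[ℝ] E} {S U : ℤ → ℤ → E →L[ℝ] E} {K α δ : ℝ}

theorem green_succ (h : IsIntDichotomy A P S U K α) (k j : ℤ) :
    green S U (k + 1) j = A k * (green S U k j + if j = k then 1 else 0) := by
  rcases lt_trichotomy j k with hj | rfl | hj
  · rw [green, green, if_pos hj, if_pos (by omega), if_neg hj.ne, add_zero,
      h.stable_succ _ _ hj.le]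
  · rw [green, green, if_neg (lt_irrefl _), if_pos (by omega), if_pos rfl, h.unstable_self,
      ← h.stable_succ _ _ le_rfl, h.stable_self]
    congr 1
    abel
  · rw [green, green, if_neg (by omega), if_neg (by omega), if_neg hj.ne', add_zero, mul_neg,
      h.unstable_succ _ _ hj]

theorem norm_green_le (h : IsIntDichotomy A P S U K α) (k j : ℤ) :
    ‖green S U k j‖ ≤ K * expKernel α (k - j) := by
  rw [green]
  split_ifs with hj
  · exact h.norm_stable_le _ _ hj.le
  · rw [norm_neg, expKernel_sub_comm]
    exact h.norm_unstable_le _ _ (not_lt.1 hj)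

theorem norm_green_add_le (h : IsIntDichotomy A P S U K α) (k m : ℤ) :
    ‖green S U k m + if k = m then 1 else 0‖ ≤ K * expKernel α (k - m) := by
  by_cases hk : k = m
  · subst hk
    rw [green, if_neg (lt_irrefl _), if_pos rfl, h.unstable_self, neg_sub, sub_add_cancel,
      ← h.stable_self]
    exact h.norm_stable_le _ _ le_rfl
  · rw [if_neg hk, add_zero]
    exact h.norm_green_le k m

theorem K_nonneg (h : IsIntDichotomy A P S U K α) : 0 ≤ K := by
  have := (norm_nonneg _).trans (h.norm_green_le 0 0)
  rwa [sub_zero, expKernel_zero, mul_one] at this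

theorem norm_green_apply_le (h : IsIntDichotomy A P S U K α) (f : ℤ → E) (k j : ℤ) :
    ‖green S U k j (f j)‖ ≤ K * (expKernel α (k - j) * ‖f j‖) := by
  rw [← mul_assoc]
  exact ContinuousLinearMap.le_of_opNorm_le _ (h.norm_green_le k j) _

theorem norm_greenSum_perturbation_le (h : IsIntDichotomy A P S U K α) (hα : 0 < α)
    (hB : ∀ k, ‖B k‖ ≤ δ) {f : ℤ → E} {M : ℝ} (hf : ∀ j, ‖f j‖ ≤ M) (k : ℤ) :
    ‖greenSum S U (fun j => B j (f j)) k‖ ≤ K * δ * ∑' j, expKernel α (k - j) * ‖f j‖ := by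
  refine tsum_of_norm_bounded
    ((summable_expKernel_mul_norm hα hf k).hasSum.mul_left (K * δ)) fun j => ?_
  refine (h.norm_green_apply_le (fun j => B j (f j)) k j).trans ?_
  rw [mul_assoc, mul_left_comm δ]
  refine mul_le_mul_of_nonneg_left (mul_le_mul_of_nonneg_left ?_ (expKernel_pos _ _).le) h.K_nonneg
  exact ContinuousLinearMap.le_of_opNorm_le _ (hB j) _

theorem norm_greenSum_perturbation_le_of_norm_le (h : IsIntDichotomy A P S U K α) (hα : 0 < α)
    (hB : ∀ k, ‖B k‖ ≤ δ) {f : ℤ → E} {M : ℝ} (hf : ∀ j, ‖f j‖ ≤ M) (k : ℤ) :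
    ‖greenSum S U (fun j => B j (f j)) k‖ ≤
      K * δ * ((1 - Real.exp (-α))⁻¹ * (1 + Real.exp (-α))) * M := by
  refine (h.norm_greenSum_perturbation_le hα hB hf k).trans ?_
  rw [mul_assoc (K * δ)]
  refine mul_le_mul_of_nonneg_left ?_ (mul_nonneg h.K_nonneg ((norm_nonneg _).trans (hB 0)))
  exact hasSum_le (fun j => mul_le_mul_of_nonneg_left (hf j) (expKernel_pos _ _).le)
    (summable_expKernel_mul_norm hα hf k).hasSum ((hasSum_expKernel_sub hα k).mul_right _)

theorem norm_perturbation_le (hB : ∀ k, ‖B k‖ ≤ δ) {f : ℤ → E} {M : ℝ} (hf : ∀ j, ‖f j‖ ≤ M)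
    (j : ℤ) : ‖B j (f j)‖ ≤ δ * M :=
  (ContinuousLinearMap.le_of_opNorm_le _ (hB j) _).trans
    (mul_le_mul_of_nonneg_left (hf j) ((norm_nonneg _).trans (hB j)))

/-- The only bounded solution on `ℤ` of `x(k+1) = A(k) x(k)` is zero. -/
theorem eq_zero_of_bounded (h : IsIntDichotomy A P S U K α) (hα : 0 < α) {x : ℤ → E} {M : ℝ}
    (hM : ∀ k, ‖x k‖ ≤ M) (hx : ∀ k, x (k + 1) = A k (x k)) (k : ℤ) : x k = 0 := by
  have hlim : Filter.Tendsto (fun n : ℕ => K * expKernel α n * M) Filter.atTop (nhds 0) := by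
    have h1 : Summable fun n : ℕ => expKernel α (n : ℤ) :=
      (hasSum_expKernel hα).summable.comp_injective Nat.cast_injective
    simpa using (h1.tendsto_atTop_zero.const_mul K).mul_const M
  have hzero : ∀ y : E, (∀ n : ℕ, ‖y‖ ≤ K * expKernel α n * M) → y = 0 := fun y hy =>
    norm_le_zero_iff.1 (ge_of_tendsto' hlim hy)
  have hS : ∀ m k, m ≤ k → P k (x k) = S k m (x m) := by
    intro m k hmk
    induction k, hmk using Int.leInduction with
    | base => rw [h.stable_self]
    | succ k hk ih =>
      have h1 := DFunLike.congr_fun (h.comm k) (x k)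
      have h2 := DFunLike.congr_fun (h.stable_succ m k hk) (x m)
      simp only [mul_apply_eq_comp] at h1 h2
      rw [hx, ← h1, ih, h2]
  have hU : ∀ m k, m ≤ k → x m - P m (x m) = U m k (x k) := by
    intro m k hmk
    induction k, hmk using Int.leInduction with
    | base => rw [h.unstable_self]; simp
    | succ k hk ih =>
      have h1 := DFunLike.congr_fun (h.unstable_mul m k hk) (x k)
      simp only [mul_apply_eq_comp] at h1
      rw [ih, hx, h1]
  have h1 : P k (x k) = 0 := hzero _ fun n => by
    rw [hS (k - n) k (by omega)]
    refine ContinuousLinearMap.le_of_opNorm_le_of_le _ ?_ (hM _)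
    convert h.norm_stable_le (k - n) k (by omega) using 3
    omega
  have h2 : x k - P k (x k) = 0 := hzero _ fun n => by
    rw [hU k (k + n) (by omega)]
    refine ContinuousLinearMap.le_of_opNorm_le_of_le _ ?_ (hM _)
    convert h.norm_unstable_le k (k + n) (by omega) using 3
    omega
  rwa [h1, sub_zero] at h2

variable [CompleteSpace E]

theorem summable_green (h : IsIntDichotomy A P S U K α) (hα : 0 < α) {f : ℤ → E} {M : ℝ}
    (hf : ∀ j, ‖f j‖ ≤ M) (k : ℤ) : Summable fun j => green S U k j (f j) :=
  Summable.of_norm_bounded ((summable_expKernel_mul_norm hα hf k).mul_left K)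
    (h.norm_green_apply_le f k)

theorem greenSum_succ (h : IsIntDichotomy A P S U K α) (hα : 0 < α) {f : ℤ → E} {M : ℝ}
    (hf : ∀ j, ‖f j‖ ≤ M) (k : ℤ) :
    greenSum S U f (k + 1) = A k (greenSum S U f k + f k) := by
  have h1 := (h.summable_green hα hf k).hasSum.add (hasSum_ite_eq k (f k))
  have h2 := (A k).hasSum h1
  rw [greenSum, greenSum, ← h2.tsum_eq]
  refine tsum_congr fun j => ?_
  rw [h.green_succ]
  by_cases hj : j = k
  · subst hj; simp
  · simp [hj]

theorem eq_zero_of_bounded_perturbed (h : IsIntDichotomy A P S U K α) (hα : 0 < α)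
    (hB : ∀ k, ‖B k‖ ≤ δ)
    (hδ : K * δ * ((1 - Real.exp (-α))⁻¹ * (1 + Real.exp (-α))) < 1) {x : ℤ → E} {M : ℝ}
    (hM : ∀ k, ‖x k‖ ≤ M) (hx : ∀ k, x (k + 1) = (A k * (1 + B k)) (x k)) (k : ℤ) : x k = 0 := by
  have hδ0 : 0 ≤ δ := (norm_nonneg _).trans (hB 0)
  have hf := norm_perturbation_le hB hM
  have hf' := h.norm_greenSum_perturbation_le_of_norm_le hα hB hM
  have h1 : ∀ k, x k - greenSum S U (fun j => B j (x j)) k = 0 :=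
    h.eq_zero_of_bounded hα
      (fun k => (norm_sub_le _ _).trans (add_le_add (hM k) (hf' k))) fun k => by
        rw [h.greenSum_succ hα hf, hx, mul_apply_eq_comp, ← map_sub]
        simp
  have h2 := le_of_expKernel_subsolution hα (mul_nonneg h.K_nonneg hδ0) hδ (w := fun k => ‖x k‖)
    (fun k => by rw [abs_norm]; exact hM k) (fun k =>
      (congrArg norm (sub_eq_zero.1 (h1 k))).trans_le
        (h.norm_greenSum_perturbation_le hα hB hM k)) k
  exact norm_le_zero_iff.1 h2

/-- The integral equation for the perturbed Green's function. -/
theorem exists_fixed_point (h : IsIntDichotomy A P S U K α) (hα : 0 < α)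
    (hB : ∀ k, ‖B k‖ ≤ δ)
    (hδ : K * δ * ((1 - Real.exp (-α))⁻¹ * (1 + Real.exp (-α))) < 1) (m : ℤ) (ξ : E) :
    ∃ (y : ℤ → E) (M : ℝ), (∀ k, ‖y k‖ ≤ M) ∧
      ∀ k, y k = (green S U k m + if k = m then 1 else 0) ξ +
        greenSum S U (fun j => B j (y j)) k := by
  have hδ0 : 0 ≤ δ := (norm_nonneg _).trans (hB 0)
  have hσ : 0 ≤ K * δ * ((1 - Real.exp (-α))⁻¹ * (1 + Real.exp (-α))) :=
    mul_nonneg (mul_nonneg h.K_nonneg hδ0)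
      ((hasSum_expKernel hα).nonneg fun j => (expKernel_pos _ _).le)
  have h0 : ∀ k, ‖(green S U k m + if k = m then 1 else 0) ξ‖ ≤ K * ‖ξ‖ := fun k => by
    refine ContinuousLinearMap.le_of_opNorm_le _ ((h.norm_green_add_le k m).trans ?_) _
    exact mul_le_of_le_one_right h.K_nonneg (expKernel_le_one hα.le _)
  let T : BoundedContinuousFunction ℤ E → BoundedContinuousFunction ℤ E := fun f =>
    BoundedContinuousFunction.ofNormedAddCommGroupDiscrete
      (fun k => (green S U k m + if k = m then 1 else 0) ξ + greenSum S U (fun j => B j (f j)) k)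
      _ (fun k => (norm_add_le _ _).trans (add_le_add (h0 k)
        (h.norm_greenSum_perturbation_le_of_norm_le hα hB f.norm_coe_le_norm k)))
  have hT : ContractingWith ⟨_, hσ⟩ T := by
    refine ⟨hδ, LipschitzWith.of_dist_le_mul fun f g => ?_⟩
    refine (BoundedContinuousFunction.dist_le (mul_nonneg hσ dist_nonneg)).2 fun k => ?_
    have hs := (h.summable_green hα (norm_perturbation_le hB f.norm_coe_le_norm) k).hasSum.sub
      (h.summable_green hα (norm_perturbation_le hB g.norm_coe_le_norm) k).hasSum
    have e : T f k - T g k = greenSum S U (fun j => B j ((f - g) j)) k := by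
      simp only [T, BoundedContinuousFunction.coe_ofNormedAddCommGroupDiscrete]
      rw [add_sub_add_left_eq_sub]
      refine Eq.trans hs.tsum_eq.symm (tsum_congr fun j => ?_)
      simp
    rw [dist_eq_norm, e, dist_eq_norm]
    exact h.norm_greenSum_perturbation_le_of_norm_le hα hB (f - g).norm_coe_le_norm k
  refine ⟨hT.fixedPoint, _, BoundedContinuousFunction.norm_coe_le_norm _, fun k => ?_⟩
  exact (DFunLike.congr_fun hT.fixedPoint_isFixedPt k).symm

/-- The perturbed Green's function: a forward solution on `[m, ∞)` through a point `y m`, and the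
negative of a backward solution on `(-∞, m]` through `ξ - y m`. -/
theorem exists_perturbed_green (h : IsIntDichotomy A P S U K α) (hα : 0 < α)
    (hB : ∀ k, ‖B k‖ ≤ δ)
    (hδ : K * δ * ((1 - Real.exp (-α))⁻¹ * (1 + Real.exp (-α))) < 1) {b : ℝ} (hb : 0 < b)
    (hcb : Real.cosh b = Real.cosh α - K * δ * Real.sinh α) (m : ℤ) (ξ : E) :
    ∃ y : ℤ → E, (∀ k, ‖y k‖ ≤ K * (Real.sinh α / Real.sinh b) * expKernel b (k - m) * ‖ξ‖) ∧
      ‖ξ - y m‖ ≤ K * (Real.sinh α / Real.sinh b) * ‖ξ‖ ∧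
      (∀ k, k + 1 ≠ m → y (k + 1) = (A k * (1 + B k)) (y k)) ∧
      (∀ k, k + 1 = m → y m - ξ = (A k * (1 + B k)) (y k)) ∧
      ‖y m - P m ξ‖ ≤ K * δ * ∑' j, expKernel α (m - j) * ‖y j‖ := by
  obtain ⟨y, M, hM, hy⟩ := h.exists_fixed_point hα hB hδ m ξ
  have hδ0 : 0 ≤ δ := (norm_nonneg _).trans (hB 0)
  have hf := norm_perturbation_le hB hM
  have hsum := h.norm_greenSum_perturbation_le hα hB hM
  have hmm : green S U m m + (if m = m then 1 else 0) = P m := by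
    rw [green, if_neg (lt_irrefl _), if_pos rfl, h.unstable_self, neg_sub, sub_add_cancel]
  have hsub : ∀ k, y k - (if k = m then ξ else 0) =
      green S U k m ξ + greenSum S U (fun j => B j (y j)) k := fun k => by
    nth_rewrite 1 [hy k]
    split_ifs
    · simp only [add_apply, one_apply_eq_self]; abel
    · simp
  have hstep : ∀ k, y (k + 1) - (if k + 1 = m then ξ else 0) = (A k * (1 + B k)) (y k) :=
    fun k => by
      rw [hsub, h.greenSum_succ hα hf, h.green_succ, mul_apply_eq_comp, mul_apply_eq_comp,
        ← map_add]
      congr 1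
      rw [add_apply 1 (B k), ← add_assoc]
      congr 1
      simp only [@eq_comm _ m k]
      exact (hy k).symm
  have hmax : ∀ k, |max ‖y k‖ ‖y k - (if k = m then ξ else 0)‖| ≤ M + ‖ξ‖ := fun k => by
    rw [abs_of_nonneg (le_max_of_le_left (norm_nonneg _))]
    refine max_le (by linarith [hM k, norm_nonneg ξ])
      ((norm_sub_le _ _).trans (add_le_add (hM k) ?_))
    split_ifs <;> simp
  have hu := le_of_expKernel_inequality hα hb (mul_nonneg h.K_nonneg hδ0) hδ hcb
    (u := fun k => max ‖y k‖ ‖y k - (if k = m then ξ else 0)‖) (M := M + ‖ξ‖) (K := K) (c := ‖ξ‖)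
    hmax m (fun k => by
      have hle := mul_le_mul_of_nonneg_left (Summable.tsum_le_tsum
        (fun j => mul_le_mul_of_nonneg_left (le_max_left ‖y j‖ ‖y j - (if j = m then ξ else 0)‖)
          (expKernel_pos α (k - j)).le)
        (summable_expKernel_mul_norm hα hM k) (summable_expKernel_mul hα hmax k))
        (mul_nonneg h.K_nonneg hδ0)
      refine le_trans (max_le ?_ ?_) (add_le_add_right hle _)
      · nth_rewrite 1 [hy k]
        exact (norm_add_le _ _).trans (add_le_add
          (ContinuousLinearMap.le_of_opNorm_le _ (h.norm_green_add_le k m) _) (hsum k))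
      · rw [hsub k]
        exact (norm_add_le _ _).trans (add_le_add
          (ContinuousLinearMap.le_of_opNorm_le _ (h.norm_green_le k m) _) (hsum k)))
  refine ⟨y, fun k => (le_max_left _ _).trans (hu k), ?_, fun k hk => ?_, fun k hk => ?_, ?_⟩
  · have := (le_max_right _ _).trans (hu m)
    rw [sub_self, expKernel_zero, mul_one, if_pos rfl] at this
    rwa [norm_sub_rev]
  · rw [← hstep, if_neg hk, sub_zero]
  · rw [← hstep, if_pos hk, hk]
  · have := hy m
    rw [hmm] at this
    nth_rewrite 1 [this]
    rw [add_sub_cancel_left]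
    exact hsum m

end IsIntDichotomy

end Green


section Trace

variable {E : Type*} [NormedAddCommGroup E] [NormedSpace ℝ E]

/-! ### Initial values of bounded solutions -/

/-- The values at `m` of the solutions of `x(k+1) = C(k) x(k)` on `I` that are bounded on `I`. -/
def boundedTrace (C : ℤ → E →L[ℝ] E) (I : Set ℤ) (m : ℤ) : Submodule ℝ E where
  carrier := {ξ | ∃ (x : ℤ → E) (M : ℝ), (∀ k ∈ I, ‖x k‖ ≤ M) ∧
    (∀ k ∈ equationDomain I, x (k + 1) = C k (x k)) ∧ x m = ξ}
  zero_mem' := ⟨0, 0, by simp, by simp, rfl⟩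
  add_mem' := by
    rintro _ _ ⟨x, M, hM, hx, rfl⟩ ⟨y, N, hN, hy, rfl⟩
    refine ⟨x + y, M + N, fun k hk => (norm_add_le _ _).trans (add_le_add (hM k hk) (hN k hk)),
      fun k hk => ?_, rfl⟩
    simp [hx k hk, hy k hk]
  smul_mem' := by
    rintro c _ ⟨x, M, hM, hx, rfl⟩
    refine ⟨c • x, ‖c‖ * M, fun k hk => ?_, fun k hk => by simp [hx k hk], rfl⟩
    rw [Pi.smul_apply, norm_smul]
    exact mul_le_mul_of_nonneg_left (hM k hk) (norm_nonneg c)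

theorem map_mem_boundedTrace_Ici {C : ℤ → E →L[ℝ] E} {m : ℤ} {ξ : E}
    (h : ξ ∈ boundedTrace C (Set.Ici m) m) : C m ξ ∈ boundedTrace C (Set.Ici (m + 1)) (m + 1) := by
  obtain ⟨x, M, hM, hx, rfl⟩ := h
  refine ⟨x, M, fun k hk => hM k ?_, fun k hk => hx k ?_, hx m ?_⟩
  all_goals simp only [equationDomain, Set.mem_ofPred_eq, Set.mem_Ici] at *; omega

theorem map_mem_boundedTrace_Iic {C : ℤ → E →L[ℝ] E} {m : ℤ} {ξ : E}
    (h : ξ ∈ boundedTrace C (Set.Iic m) m) : C m ξ ∈ boundedTrace C (Set.Iic (m + 1)) (m + 1) := by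
  obtain ⟨x, M, hM, hx, rfl⟩ := h
  refine ⟨fun k => if k ≤ m then x k else C m (x m), max M ‖C m (x m)‖, fun k hk => ?_,
    fun k hk => ?_, ?_⟩
  · dsimp only
    split_ifs with h
    · exact (hM k h).trans (le_max_left _ _)
    · exact le_max_right _ _
  · have hk2 : k + 1 ≤ m + 1 := hk.2
    dsimp only
    rw [if_pos (show k ≤ m by omega)]
    split_ifs with h
    · exact hx k ⟨by simp only [Set.mem_Iic]; omega, h⟩
    · rw [show k = m by omega]
  · dsimp only
    rw [if_neg (by omega)]

theorem exists_map_eq_of_mem_boundedTrace_Iic {C : ℤ → E →L[ℝ] E} {m : ℤ} {ξ : E}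
    (h : ξ ∈ boundedTrace C (Set.Iic (m + 1)) (m + 1)) :
    ∃ η ∈ boundedTrace C (Set.Iic m) m, C m η = ξ := by
  obtain ⟨x, M, hM, hx, rfl⟩ := h
  refine ⟨x m, ⟨x, M, fun k hk => hM k ?_, fun k hk => hx k ?_, rfl⟩, (hx m ?_).symm⟩
  all_goals simp only [equationDomain, Set.mem_ofPred_eq, Set.mem_Iic] at *; omega

theorem mem_boundedTrace_Ici_of_map_eq_zero {C : ℤ → E →L[ℝ] E} {m : ℤ} {ξ : E}
    (h : C m ξ = 0) : ξ ∈ boundedTrace C (Set.Ici m) m := by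
  refine ⟨fun k => if k = m then ξ else 0, ‖ξ‖, fun k _ => ?_, fun k hk => ?_, if_pos rfl⟩
  · dsimp only
    split_ifs <;> simp
  · have hk1 : m ≤ k := hk.1
    dsimp only
    rw [if_neg (by omega)]
    split_ifs with hkm
    · rw [hkm, h]
    · simp

/-- If zero is the only bounded solution on `ℤ`, then forward and backward bounded solutions
are transversal. -/
theorem disjoint_boundedTrace {C : ℤ → E →L[ℝ] E}
    (h0 : ∀ (x : ℤ → E) (M : ℝ), (∀ k, ‖x k‖ ≤ M) → (∀ k, x (k + 1) = C k (x k)) → ∀ k, x k = 0)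
    (m : ℤ) : Disjoint (boundedTrace C (Set.Ici m) m) (boundedTrace C (Set.Iic m) m) := by
  rw [Submodule.disjoint_def]
  rintro ξ ⟨x, M, hM, hx, rfl⟩ ⟨y, N, hN, hy, hxy⟩
  have := h0 (fun k => if m ≤ k then x k else y k) (max M N) (fun k => ?_) (fun k => ?_) m
  · simpa using this
  · split_ifs with h
    · exact (hM k h).trans (le_max_left _ _)
    · exact (hN k (not_le.1 h).le).trans (le_max_right _ _)
  · rcases lt_trichotomy (k + 1) m with hk | hk | hk
    · rw [if_neg (by omega), if_neg (by omega)]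
      exact hy k ⟨by simp only [Set.mem_Iic]; omega, hk.le⟩
    · rw [if_pos hk.ge, if_neg (by omega), hk, ← hxy, ← hk]
      exact hy k ⟨by simp only [Set.mem_Iic]; omega, hk.le⟩
    · rw [if_pos (by omega), if_pos (by omega)]
      exact hx k ⟨by simp only [Set.mem_Ici]; omega, hk.le⟩

theorem transition_apply_solution {C : ℤ → E →L[ℝ] E} {x : ℤ → E} {m k : ℤ} (hmk : m ≤ k)
    (hx : ∀ j, m ≤ j → j < k → x (j + 1) = C j (x j)) : transition C k m (x m) = x k := by
  have key : ∀ n : ℕ, m + n ≤ k → transitionAux C m n (x m) = x (m + n) := by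
    intro n
    induction n with
    | zero => intro _; simp [transitionAux]
    | succ n ih =>
      intro hn
      push_cast at hn ⊢
      rw [transitionAux, mul_apply_eq_comp, ih (by omega), ← hx _ (by omega) (by omega), add_assoc]
  rw [transition, key _ (by omega)]
  congr 1
  omega

end Trace

section Perturbation

variable {E : Type*} [NormedAddCommGroup E] [NormedSpace ℝ E]
  {A P B : ℤ → E →L[ℝ] E} {S U : ℤ → ℤ → E →L[ℝ] E} {K α δ : ℝ}

namespace IsIntDichotomy

theorem disjoint_boundedTrace_Ici_ker [CompleteSpace E] (h : IsIntDichotomy A P S U K α)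
    (hα : 0 < α) (hB : ∀ k, ‖B k‖ ≤ δ)
    (hδ : K * δ * ((1 - Real.exp (-α))⁻¹ * (1 + Real.exp (-α))) < 1) (m : ℤ) :
    Disjoint (boundedTrace (fun k => A k * (1 + B k)) (Set.Ici m) m) (P m).ker := by
  have hδ0 : 0 ≤ δ := (norm_nonneg _).trans (hB 0)
  rw [Submodule.disjoint_def]
  rintro ξ ⟨x, M, hM, hx, rfl⟩ hP
  have hP : P m (x m) = 0 := hP
  have := h.eq_zero_of_bounded_perturbed hα (B := fun k => if m ≤ k then B k else 0)
    (fun k => by split_ifs; exacts [hB k, by simpa using hδ0]) hδ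
    (x := fun k => if m ≤ k then x k else U k m (x m)) (M := max M (K * ‖x m‖)) (fun k => ?_)
    (fun k => ?_) m
  · simpa using this
  · split_ifs with hk
    · exact (hM k hk).trans (le_max_left _ _)
    · refine le_trans ?_ (le_max_right _ _)
      refine ContinuousLinearMap.le_of_opNorm_le _
        ((h.norm_unstable_le k m (not_le.1 hk).le).trans ?_) _
      exact mul_le_of_le_one_right h.K_nonneg (expKernel_le_one hα.le _)
  · rcases lt_trichotomy (k + 1) m with hk | hk | hk
    · rw [if_neg (by omega), if_neg (by omega), if_neg (by omega), add_zero, mul_one,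
        ← h.unstable_succ k m (by omega), mul_apply_eq_comp]
    · rw [if_pos (by omega), if_neg (by omega), if_neg (by omega), add_zero, mul_one,
        ← mul_apply_eq_comp, h.unstable_succ k m (by omega), hk, h.unstable_self]
      simp [hP]
    · rw [if_pos (by omega), if_pos (by omega), if_pos (by omega)]
      exact hx k ⟨by simp only [Set.mem_Ici]; omega, hk.le⟩

theorem disjoint_boundedTrace_Iic_range [CompleteSpace E] (h : IsIntDichotomy A P S U K α)
    (hα : 0 < α) (hB : ∀ k, ‖B k‖ ≤ δ)
    (hδ : K * δ * ((1 - Real.exp (-α))⁻¹ * (1 + Real.exp (-α))) < 1) (m : ℤ) :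
    Disjoint (boundedTrace (fun k => A k * (1 + B k)) (Set.Iic m) m) (P m).range := by
  have hδ0 : 0 ≤ δ := (norm_nonneg _).trans (hB 0)
  rw [Submodule.disjoint_def]
  rintro ξ ⟨x, M, hM, hx, rfl⟩ ⟨η, hη⟩
  have hη : P m η = x m := hη
  have hP : P m (x m) = x m := by rw [← hη, ← mul_apply_eq_comp, h.proj]
  have := h.eq_zero_of_bounded_perturbed hα (B := fun k => if k < m then B k else 0)
    (fun k => by split_ifs; exacts [hB k, by simpa using hδ0]) hδ
    (x := fun k => if k ≤ m then x k else S k m (x m)) (M := max M (K * ‖x m‖)) (fun k => ?_)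
    (fun k => ?_) m
  · simpa using this
  · split_ifs with hk
    · exact (hM k hk).trans (le_max_left _ _)
    · refine le_trans ?_ (le_max_right _ _)
      refine ContinuousLinearMap.le_of_opNorm_le _
        ((h.norm_stable_le m k (not_le.1 hk).le).trans ?_) _
      exact mul_le_of_le_one_right h.K_nonneg (expKernel_le_one hα.le _)
  · rcases lt_trichotomy k m with hk | hk | hk
    · rw [if_pos (by omega), if_pos (by omega), if_pos (by omega)]
      exact hx k ⟨hk.le, by simp only [Set.mem_Iic]; omega⟩
    · subst hk
      rw [if_neg (by omega), if_pos le_rfl, if_neg (lt_irrefl _), add_zero, mul_one,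
        ← h.stable_succ k k le_rfl, h.stable_self, mul_apply_eq_comp, hP]
    · rw [if_neg (by omega), if_neg (by omega), if_neg (by omega), add_zero, mul_one,
        ← h.stable_succ m k (by omega), mul_apply_eq_comp]

/-- Roughness of exponential dichotomies on `ℤ`. -/
theorem exists_perturbed_projection [FiniteDimensional ℝ E] (h : IsIntDichotomy A P S U K α)
    (hα : 0 < α) (hB : ∀ k, ‖B k‖ ≤ δ)
    (hδ : K * δ * ((1 - Real.exp (-α))⁻¹ * (1 + Real.exp (-α))) < 1) {b β L : ℝ} (hb : 0 < b)
    (hcb : Real.cosh b = Real.cosh α - K * δ * Real.sinh α) (hβ : 0 < β) (hβb : β ≤ b)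
    (hL : K * (Real.sinh α / Real.sinh b) ≤ L) :
    ∃ Q : ℤ → E →L[ℝ] E, (∀ k, Q k * Q k = Q k) ∧
      (∀ k, Module.finrank ℝ (Q k).range = Module.finrank ℝ (P k).range) ∧
      (∀ k, A k * (1 + B k) * Q k = Q (k + 1) * (A k * (1 + B k))) ∧
      (∀ k, Set.BijOn (⇑(A k * (1 + B k))) (Q k).ker (Q (k + 1)).ker) ∧
      (∀ m k, m ≤ k → ‖transition (fun k => A k * (1 + B k)) k m * Q m‖ ≤
        L * expKernel β (k - m)) ∧
      (∀ m k, m ≤ k → ∀ ξ η, Q m η = 0 →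
        transition (fun k => A k * (1 + B k)) k m η = ξ - Q k ξ →
        ‖η‖ ≤ L * expKernel β (k - m) * ‖ξ‖) ∧
      ∀ k, ‖Q k - P k‖ ≤
        K * L * (1 - Real.exp (-(α + β)))⁻¹ * (1 + Real.exp (-(α + β))) * δ := by
  have : CompleteSpace E := FiniteDimensional.complete ℝ E
  have hδ0 : 0 ≤ δ := (norm_nonneg _).trans (hB 0)
  set C : ℤ → E →L[ℝ] E := fun k => A k * (1 + B k) with hC
  have hL0 : 0 ≤ L := le_trans (mul_nonneg h.K_nonneg
    (div_nonneg (Real.sinh_pos_iff.2 hα).le (Real.sinh_pos_iff.2 hb).le)) hL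
  let Vs := fun m => boundedTrace C (Set.Ici m) m
  let Vu := fun m => boundedTrace C (Set.Iic m) m
  have hdisj : ∀ m, Disjoint (Vs m) (Vu m) := disjoint_boundedTrace
    fun x M hM hx => h.eq_zero_of_bounded_perturbed hα hB hδ hM hx
  have hy : ∀ m ξ, ∃ y : ℤ → E, (∀ k, ‖y k‖ ≤ L * expKernel β (k - m) * ‖ξ‖) ∧
      ‖ξ - y m‖ ≤ L * ‖ξ‖ ∧ (∀ k, k + 1 ≠ m → y (k + 1) = C k (y k)) ∧
      (∀ k, k + 1 = m → y m - ξ = C k (y k)) ∧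
      ‖y m - P m ξ‖ ≤ K * δ * ∑' j, expKernel α (m - j) * ‖y j‖ := fun m ξ => by
    obtain ⟨y, h1, h2, h3⟩ := h.exists_perturbed_green hα hB hδ hb hcb m ξ
    refine ⟨y, fun k => (h1 k).trans ?_, h2.trans ?_, h3⟩
    · exact mul_le_mul_of_nonneg_right (mul_le_mul hL (expKernel_anti hβb _)
        (expKernel_pos _ _).le hL0) (norm_nonneg ξ)
    · exact mul_le_mul_of_nonneg_right hL (norm_nonneg ξ)
  choose Y hYn hYm hYs hYj hYP using hy
  have hYb : ∀ m ξ k, ‖Y m ξ k‖ ≤ L * ‖ξ‖ := fun m ξ k => (hYn m ξ k).trans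
    (mul_le_mul_of_nonneg_right (mul_le_of_le_one_right hL0 (expKernel_le_one hβ.le _))
      (norm_nonneg ξ))
  -- the backward solution through `ξ - Y m ξ m`
  let Z : ℤ → E → ℤ → E := fun m ξ k => if k < m then -Y m ξ k else ξ - Y m ξ m
  have hZn : ∀ m ξ k, k ≤ m → ‖Z m ξ k‖ ≤ L * expKernel β (k - m) * ‖ξ‖ := fun m ξ k hk => by
    simp only [Z]
    split_ifs with hkm
    · rw [norm_neg]; exact hYn m ξ k
    · rw [show k = m by omega, sub_self, expKernel_zero, mul_one]; exact hYm m ξ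
  have hZs : ∀ m ξ k, k < m → Z m ξ (k + 1) = C k (Z m ξ k) := fun m ξ k hk => by
    simp only [Z]
    rw [if_pos hk]
    split_ifs with hkm
    · rw [map_neg, hYs m ξ k (by omega)]
    · rw [map_neg, ← hYj m ξ k (by omega), neg_sub]
  have hYmem : ∀ m ξ, Y m ξ m ∈ Vs m := fun m ξ =>
    ⟨Y m ξ, L * ‖ξ‖, fun k _ => hYb m ξ k, fun k hk => hYs m ξ k (by
      have : m ≤ k := hk.1
      omega), rfl⟩
  have hZmem' : ∀ m ξ j, j ≤ m → Z m ξ j ∈ Vu j := fun m ξ j hj =>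
    ⟨Z m ξ, L * ‖ξ‖, fun k hk => (hZn m ξ k (le_trans hk hj)).trans
      (mul_le_mul_of_nonneg_right (mul_le_of_le_one_right hL0 (expKernel_le_one hβ.le _))
        (norm_nonneg ξ)), fun k hk => hZs m ξ k (by
      have : k + 1 ≤ j := hk.2
      omega), rfl⟩
  have hZmem : ∀ m ξ, ξ - Y m ξ m ∈ Vu m := fun m ξ => by
    have := hZmem' m ξ m le_rfl
    simpa [Z] using this
  have hcompl : ∀ m, IsCompl (Vs m) (Vu m) := fun m => ⟨hdisj m, by
    rw [codisjoint_iff, eq_top_iff]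
    intro ξ _
    exact Submodule.mem_sup.2 ⟨_, hYmem m ξ, _, hZmem m ξ, by abel⟩⟩
  let Q : ℤ → E →L[ℝ] E := fun m =>
    LinearMap.toContinuousLinearMap ((Vs m).projection (Vu m) (hcompl m))
  have hQs : ∀ m, ∀ ξ ∈ Vs m, Q m ξ = ξ := fun m ξ hξ =>
    Submodule.projection_apply_left (hcompl m) ⟨ξ, hξ⟩
  have hQu : ∀ m, ∀ ξ ∈ Vu m, Q m ξ = 0 := fun m ξ hξ =>
    Submodule.projection_apply_of_mem_right (hcompl m) hξ
  have hQY : ∀ m ξ, Q m ξ = Y m ξ m := fun m ξ => by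
    have : Q m ξ = Q m (Y m ξ m) + Q m (ξ - Y m ξ m) := by rw [← map_add]; congr 1; abel
    rw [this, hQs m _ (hYmem m ξ), hQu m _ (hZmem m ξ), add_zero]
  have hker : ∀ m, (Q m).ker = Vu m := fun m => le_antisymm (fun ξ (hξ : Q m ξ = 0) => by
    have := hZmem m ξ
    rwa [← hQY, hξ, sub_zero] at this) (fun ξ hξ => hQu m ξ hξ)
  have hrange : ∀ m, (Q m).range = Vs m := fun m => le_antisymm (by
    rintro _ ⟨ξ, rfl⟩
    exact (hQY m ξ).symm ▸ hYmem m ξ) (fun ξ hξ => ⟨ξ, hQs m ξ hξ⟩)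
  have hinj : ∀ k, ∀ ξ ∈ Vu k, C k ξ = 0 → ξ = 0 := fun k ξ hξ h0 =>
    Submodule.disjoint_def.1 (hdisj k) ξ (mem_boundedTrace_Ici_of_map_eq_zero h0) hξ
  have hbij : ∀ k, Set.BijOn (C k) (Q k).ker (Q (k + 1)).ker := fun k => by
    rw [hker, hker]
    refine ⟨fun ξ hξ => map_mem_boundedTrace_Iic hξ, fun ξ hξ η hη hξη => ?_, fun ξ hξ => ?_⟩
    · refine sub_eq_zero.1 (hinj k _ ((Vu k).sub_mem hξ hη) ?_)
      rw [map_sub, hξη, sub_self]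
    · exact exists_map_eq_of_mem_boundedTrace_Iic hξ
  refine ⟨Q, fun m => ?_, fun m => ?_, fun m => ?_, hbij, fun m k hmk => ?_,
    fun m k hmk ξ η hη hηξ => ?_, fun m => ?_⟩
  · ext ξ
    rw [mul_apply_eq_comp, hQY m ξ]
    exact hQs m _ (hYmem m ξ)
  · rw [hrange]
    have h1 : Module.finrank ℝ (Vs m) + _ ≤ _ := Submodule.finrank_add_finrank_le_of_disjoint
      (h.disjoint_boundedTrace_Ici_ker hα hB hδ m)
    have h2 : Module.finrank ℝ (Vu m) + _ ≤ _ := Submodule.finrank_add_finrank_le_of_disjoint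
      (h.disjoint_boundedTrace_Iic_range hα hB hδ m)
    have h3 := Submodule.finrank_add_eq_of_isCompl (hcompl m)
    have h4 := LinearMap.finrank_range_add_finrank_ker (P m).toLinearMap
    omega
  · ext ξ
    have e : C m ξ = C m (Q m ξ) + C m (ξ - Q m ξ) := by rw [← map_add]; congr 1; abel
    change C m (Q m ξ) = Q (m + 1) (C m ξ)
    rw [e, map_add, hQs (m + 1) _ (map_mem_boundedTrace_Ici (hQY m ξ ▸ hYmem m ξ)),
      hQu (m + 1) _ (map_mem_boundedTrace_Iic (hQY m ξ ▸ hZmem m ξ)), add_zero]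
  · refine ContinuousLinearMap.opNorm_le_bound _
      (mul_nonneg hL0 (expKernel_pos _ _).le) fun ξ => ?_
    rw [mul_apply_eq_comp, hQY, transition_apply_solution hmk fun j hj _ => hYs m ξ j (by omega)]
    exact hYn m ξ k
  · have hZ : transition C k m (Z k ξ m) = ξ - Q k ξ := by
      rw [transition_apply_solution hmk fun j _ hj => hZs k ξ j hj, hQY]
      simp [Z]
    have hI := (transition_bijOn (J := Set.univ) (fun k _ => hbij k) (Set.mem_univ m)
      (Set.mem_univ k) hmk).injOn
    have : η = Z k ξ m := hI hη (hQu m _ (hZmem' k ξ m hmk)) (hηξ.trans hZ.symm)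
    rw [this, expKernel_sub_comm]
    exact hZn k ξ m hmk
  · have hαβ : 0 < α + β := by linarith
    have hσ := hasSum_expKernel_sub hαβ m
    refine ContinuousLinearMap.opNorm_le_bound _ ?_ fun ξ => ?_
    · have := hσ.nonneg fun j => (expKernel_pos _ _).le
      rw [show K * L * (1 - Real.exp (-(α + β)))⁻¹ * (1 + Real.exp (-(α + β))) * δ =
        K * L * ((1 - Real.exp (-(α + β)))⁻¹ * (1 + Real.exp (-(α + β)))) * δ by ring]
      exact mul_nonneg (mul_nonneg (mul_nonneg h.K_nonneg hL0) this) hδ0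
    · rw [sub_apply, hQY]
      refine (hYP m ξ).trans ?_
      have h1 : ∑' j, expKernel α (m - j) * ‖Y m ξ j‖ ≤
          ((1 - Real.exp (-(α + β)))⁻¹ * (1 + Real.exp (-(α + β)))) * (L * ‖ξ‖) := by
        refine hasSum_le (fun j => ?_)
          (summable_expKernel_mul_norm hα (hYb m ξ) m).hasSum (hσ.mul_right (L * ‖ξ‖))
        refine (mul_le_mul_of_nonneg_left (hYn m ξ j) (expKernel_pos _ _).le).trans_eq ?_
        rw [← expKernel_mul, expKernel_sub_comm β m j]
        ring
      refine (mul_le_mul_of_nonneg_left h1 (mul_nonneg h.K_nonneg hδ0)).trans_eq ?_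
      ring

end IsIntDichotomy

end Perturbation


section Transition

variable {E : Type*} [NormedAddCommGroup E] [NormedSpace ℝ E]

theorem transition_self (A : ℤ → E →L[ℝ] E) (m : ℤ) : transition A m m = 1 := by
  simp [transition, transitionAux]

theorem transition_succ (A : ℤ → E →L[ℝ] E) {m k : ℤ} (h : m ≤ k) :
    transition A (k + 1) m = A k * transition A k m := by
  rw [transition, transition, show (k + 1 - m).toNat = (k - m).toNat + 1 by omega, transitionAux]
  congr 2
  omega

theorem transition_succ_self (A : ℤ → E →L[ℝ] E) (m : ℤ) : transition A (m + 1) m = A m := by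
  rw [transition_succ A le_rfl, transition_self, mul_one]

theorem transition_eq_mul (A : ℤ → E →L[ℝ] E) {m k : ℤ} (h : m < k) :
    transition A k m = transition A k (m + 1) * A m := by
  have h' : m + 1 ≤ k := h
  induction k, h' using Int.leInduction with
  | base => rw [transition_self, transition_succ_self, one_mul]
  | succ k hk ih =>
    rw [transition_succ A (by omega), transition_succ A hk, ih (by omega), mul_assoc]

theorem transition_congr {A C : ℤ → E →L[ℝ] E} {m k : ℤ} (hmk : m ≤ k)
    (h : ∀ j, m ≤ j → j < k → A j = C j) : transition A k m = transition C k m := by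
  induction k, hmk using Int.leInduction with
  | base => rw [transition_self, transition_self]
  | succ k hk ih =>
    rw [transition_succ A hk, transition_succ C hk, ih fun j h1 h2 => h j h1 (by omega),
      h k hk (by omega)]

theorem transition_mul_comm {A Q : ℤ → E →L[ℝ] E} (h : ∀ k, A k * Q k = Q (k + 1) * A k)
    {m k : ℤ} (hmk : m ≤ k) : transition A k m * Q m = Q k * transition A k m := by
  induction k, hmk using Int.leInduction with
  | base => rw [transition_self, one_mul, mul_one]
  | succ k hk ih => rw [transition_succ A hk, mul_assoc, ih, ← mul_assoc, h, mul_assoc]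

theorem exp_mul_norm_le {K α : ℝ} {c d n : ℤ} {T : E →L[ℝ] E}
    (hT : ‖T‖ ≤ K * Real.exp (-α * ((c : ℝ) - d)))    (hn : 0 ≤ n) :
    ‖Real.exp (-α * ((n : ℝ) - (c - d))) • T‖ ≤ K * expKernel α n := by
  rw [norm_smul, Real.norm_eq_abs, Real.abs_exp]
  refine (mul_le_mul_of_nonneg_left hT (Real.exp_pos _).le).trans_eq ?_
  rw [mul_left_comm, ← Real.exp_add, expKernel_of_nonneg _ hn]
  congr 2
  ring

end Transition

section Extension

variable {E : Type*} [NormedAddCommGroup E] [NormedSpace ℝ E] [FiniteDimensional ℝ E]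
  {J : Set ℤ} {A P : ℤ → E →L[ℝ] E} {r : ℕ} {K α : ℝ}

namespace HasExpDichotomy

theorem comm (h : HasExpDichotomy J A P r K α) {k : ℤ} (hk : k ∈ equationDomain J) :
    A k * P k = P (k + 1) * A k := by
  have := h.invariant k hk.1 (k + 1) hk.2 (by omega)
  rwa [transition_succ_self] at this

theorem proj_mul_stable (h : HasExpDichotomy J A P r K α) {m k : ℤ} (hm : m ∈ J) (hk : k ∈ J)
    (hmk : m ≤ k) : P k * (transition A k m * P m) = transition A k m * P m := by
  rw [← mul_assoc, ← h.invariant m hm k hk hmk, mul_assoc, h.proj m hm]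

variable [J.OrdConnected]

theorem proj_mul_backwardOperator (h : HasExpDichotomy J A P r K α) {m k : ℤ} (hm : m ∈ J)
    (hk : k ∈ J) (hmk : m ≤ k) : P m * backwardOperator A P m k = 0 := by
  ext x
  exact (backwardOperator_spec (h.proj k hk) (transition_bijOn h.bijOn hm hk hmk) x).1

theorem transition_mul_cancel (h : HasExpDichotomy J A P r K α) {m k : ℤ} (hm : m ∈ J)
    (hk : k ∈ J) (hmk : m ≤ k) {T T' : E →L[ℝ] E} (hT : P m * T = 0) (hT' : P m * T' = 0)
    (hTT' : transition A k m * T = transition A k m * T') : T = T' := by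
  ext x
  exact (transition_bijOn h.bijOn hm hk hmk).injOn (DFunLike.congr_fun hT x)
    (DFunLike.congr_fun hT' x) (DFunLike.congr_fun hTT' x)

theorem transition_mul_backwardOperator (h : HasExpDichotomy J A P r K α) {m k : ℤ} (hm : m ∈ J)
    (hk : k ∈ J) (hmk : m ≤ k) : transition A k m * backwardOperator A P m k = 1 - P k := by
  ext x
  exact (backwardOperator_spec (h.proj k hk) (transition_bijOn h.bijOn hm hk hmk) x).2

theorem eq_backwardOperator (h : HasExpDichotomy J A P r K α) {m k : ℤ} (hm : m ∈ J) (hk : k ∈ J)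
    (hmk : m ≤ k) {T : E →L[ℝ] E} (hT : P m * T = 0) (hT' : transition A k m * T = 1 - P k) :
    T = backwardOperator A P m k :=
  h.transition_mul_cancel hm hk hmk hT (h.proj_mul_backwardOperator hm hk hmk)
    (hT'.trans (h.transition_mul_backwardOperator hm hk hmk).symm)

theorem backwardOperator_self (h : HasExpDichotomy J A P r K α) {m : ℤ} (hm : m ∈ J) :
    backwardOperator A P m m = 1 - P m := by
  refine (h.eq_backwardOperator hm hm le_rfl ?_ ?_).symm
  · rw [mul_sub, mul_one, h.proj m hm, sub_self]
  · rw [transition_self, one_mul]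

theorem mul_backwardOperator (h : HasExpDichotomy J A P r K α) {m k : ℤ}
    (hk : k ∈ equationDomain J) (hm : m ∈ J) (hkm : k < m) :
    A k * backwardOperator A P k m = backwardOperator A P (k + 1) m := by
  refine h.eq_backwardOperator hk.2 hm hkm ?_ ?_
  · rw [← mul_assoc, ← h.comm hk, mul_assoc, h.proj_mul_backwardOperator hk.1 hm hkm.le, mul_zero]
  · rw [← mul_assoc, ← transition_eq_mul A hkm, h.transition_mul_backwardOperator hk.1 hm hkm.le]

theorem backwardOperator_mul (h : HasExpDichotomy J A P r K α) {m k : ℤ} (hm : m ∈ J)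
    (hk : k ∈ equationDomain J) (hmk : m ≤ k) :
    backwardOperator A P m (k + 1) * A k = backwardOperator A P m k := by
  have hmk' : m ≤ k + 1 := by omega
  refine h.transition_mul_cancel hm hk.2 hmk' ?_ (h.proj_mul_backwardOperator hm hk.1 hmk) ?_
  · rw [← mul_assoc, h.proj_mul_backwardOperator hm hk.2 hmk', zero_mul]
  · rw [← mul_assoc, h.transition_mul_backwardOperator hm hk.2 hmk', transition_succ A hmk,
      mul_assoc, h.transition_mul_backwardOperator hm hk.1 hmk, sub_mul, one_mul, mul_sub, mul_one,
      h.comm hk]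

theorem backwardOperator_mul_proj (h : HasExpDichotomy J A P r K α) {m k : ℤ} (hm : m ∈ J)
    (hk : k ∈ J) (hmk : m ≤ k) : backwardOperator A P m k * P k = 0 := by
  refine h.transition_mul_cancel hm hk hmk ?_ (mul_zero _) ?_
  · rw [← mul_assoc, h.proj_mul_backwardOperator hm hk hmk, zero_mul]
  · rw [← mul_assoc, h.transition_mul_backwardOperator hm hk hmk, sub_mul, one_mul, h.proj k hk,
      sub_self, mul_zero]

open Classical in
/-- A dichotomy on `J` extends to `ℤ` with the same constants, with the autonomous equation
`x(k+1) = (e^{-α}P + e^{α}(I - P))x(k)` outside `J`. The map `c` is the retraction onto `J`. -/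
theorem exists_extension (h : HasExpDichotomy J A P r K α) {c : ℤ → ℤ} (hc : Monotone c)
    (hcJ : ∀ k, c k ∈ J) (hid : ∀ k ∈ J, c k = k) (hout : ∀ k ∉ equationDomain J, c (k + 1) = c k) :
    ∃ S U, IsIntDichotomy
      (fun k => if k ∈ equationDomain J then A k else
        Real.exp (-α) • P (c k) + Real.exp α • (1 - P (c k)))
      (fun k => P (c k)) S U K α := by
  refine ⟨fun k m => Real.exp (-α * (((k - m : ℤ) : ℝ) - (c k - c m))) •
      (transition A (c k) (c m) * P (c m)),
    fun m k => Real.exp (-α * (((k - m : ℤ) : ℝ) - (c k - c m))) •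
      backwardOperator A P (c m) (c k), fun k => h.proj _ (hcJ k), fun k => ?_, fun m => ?_,
      fun m k hmk => ?_, fun m => ?_, fun k m hkm => ?_, fun m k hmk => ?_, fun m k hmk => ?_,
      fun m k hmk => ?_⟩
  · by_cases hk : k ∈ equationDomain J
    · rw [if_pos hk, hid k hk.1, hid _ hk.2, h.comm hk]
    · rw [if_neg hk, hout k hk]
      simp only [add_mul, mul_add, smul_mul_assoc, mul_smul_comm, sub_mul, mul_sub, one_mul,
        mul_one]
  · simp [transition_self]
  · by_cases hk : k ∈ equationDomain J
    · have hmk' := hc hmk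
      rw [if_pos hk, hid _ hk.2]
      rw [hid k hk.1] at hmk' ⊢
      rw [transition_succ A hmk', mul_smul_comm, ← mul_assoc]
      congr 2
      push_cast
      ring
    · have hP := h.proj_mul_stable (hcJ m) (hcJ k) (hc hmk)
      rw [if_neg hk, hout k hk, mul_smul_comm, add_mul, smul_mul_assoc, smul_mul_assoc, sub_mul,
        one_mul, hP, sub_self, smul_zero, add_zero, smul_smul, ← Real.exp_add]
      congr 2
      push_cast
      ring
  · simp [h.backwardOperator_self (hcJ m)]
  · by_cases hk : k ∈ equationDomain J
    · have hkm' : k < c m := by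
        have := hc (show k + 1 ≤ m from hkm)
        rw [hid _ hk.2] at this
        omega
      rw [if_pos hk, hid _ hk.2, hid k hk.1, mul_smul_comm,
        h.mul_backwardOperator hk (hcJ m) hkm']
      congr 2
      push_cast
      ring
    · have hP := h.proj_mul_backwardOperator (hcJ k) (hcJ m) (hc hkm.le)
      rw [if_neg hk, hout k hk, mul_smul_comm, add_mul, smul_mul_assoc, smul_mul_assoc, sub_mul,
        one_mul, hP, smul_zero, zero_add,
        sub_zero, smul_smul, ← Real.exp_add]
      congr 2
      push_cast
      ring
  · by_cases hk : k ∈ equationDomain J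
    · have hmk' := hc hmk
      rw [if_pos hk, hid _ hk.2]
      rw [hid k hk.1] at hmk' ⊢
      rw [smul_mul_assoc, h.backwardOperator_mul (hcJ m) hk hmk']
      congr 2
      push_cast
      ring
    · have hP := h.backwardOperator_mul_proj (hcJ m) (hcJ k) (hc hmk)
      rw [if_neg hk, hout k hk, smul_mul_assoc, mul_add, mul_smul_comm, mul_smul_comm,
        mul_sub (backwardOperator A P (c m) (c k)), mul_one, hP, smul_zero, zero_add,
        sub_zero, smul_smul, ← Real.exp_add]
      congr 2
      push_cast
      ring
  · exact exp_mul_norm_le (h.stable _ (hcJ m) _ (hcJ k) (hc hmk)) (by omega)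
  · exact exp_mul_norm_le (h.unstable _ (hcJ m) _ (hcJ k) (hc hmk)) (by omega)

end HasExpDichotomy

theorem exists_retraction {J : Set ℤ}
    (hJ : (∃ a : ℤ, J = Set.Ici a) ∨ (∃ b : ℤ, J = Set.Iic b) ∨ J = Set.univ) :
    ∃ c : ℤ → ℤ, Monotone c ∧ (∀ k, c k ∈ J) ∧ (∀ k ∈ J, c k = k) ∧
      ∀ k ∉ equationDomain J, c (k + 1) = c k := by
  rcases hJ with ⟨a, rfl⟩ | ⟨b, rfl⟩ | rfl
  · refine ⟨fun k => max a k, fun k m h => max_le_max le_rfl h, fun k => le_max_left a k,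
      fun k hk => max_eq_right hk, fun k hk => ?_⟩
    simp only [equationDomain, Set.mem_ofPred_eq, Set.mem_Ici] at hk
    dsimp only
    omega
  · refine ⟨fun k => min b k, fun k m h => min_le_min le_rfl h, fun k => min_le_left b k,
      fun k hk => min_eq_right hk, fun k hk => ?_⟩
    simp only [equationDomain, Set.mem_ofPred_eq, Set.mem_Iic] at hk
    dsimp only
    omega
  · exact ⟨id, monotone_id, fun k => Set.mem_univ _, fun k _ => rfl,
      fun k hk => (hk ⟨Set.mem_univ _, Set.mem_univ _⟩).elim⟩

end Extension

end DiffDichotomy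

theorem theorem5p2 {E : Type*} [NormedAddCommGroup E] [NormedSpace ℝ E] [FiniteDimensional ℝ E]
    (J : Set ℤ)
    (hJ : (∃ a : ℤ, J = Set.Ici a) ∨ (∃ b : ℤ, J = Set.Iic b) ∨ J = Set.univ)
    (A P B : ℤ → E →L[ℝ] E) (r : ℕ) (K α δ : ℝ)
    (hA : DiffDichotomy.HasExpDichotomy J A P r K α)
    (hB : ∀ k ∈ DiffDichotomy.equationDomain J, ‖B k‖ ≤ δ)
    (hδ : DiffDichotomy.rho K α * δ < 1) :
    ∃ Q : ℤ → E →L[ℝ] E,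
      DiffDichotomy.HasExpDichotomy J (fun k => A k * (1 + B k)) Q r
        (DiffDichotomy.newConstant K α δ) (DiffDichotomy.beta K α δ) ∧
      ∀ k ∈ J, ‖Q k - P k‖ ≤
        K * DiffDichotomy.newConstant K α δ *
          (1 - Real.exp (-(α + DiffDichotomy.beta K α δ)))⁻¹ *
          (1 + Real.exp (-(α + DiffDichotomy.beta K α δ))) * δ := by
  classical
  have hconn : J.OrdConnected := by
    rcases hJ with ⟨a, rfl⟩ | ⟨b, rfl⟩ | rfl <;> infer_instance
  have hδ0 : 0 ≤ δ := by
    rcases hJ with ⟨a, rfl⟩ | ⟨b, rfl⟩ | rfl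
    · exact (norm_nonneg _).trans (hB a ⟨Set.self_mem_Ici, by simp⟩)
    · exact (norm_nonneg _).trans (hB (b - 1) ⟨by simp, by simp⟩)
    · exact (norm_nonneg _).trans (hB 0 ⟨trivial, trivial⟩)
  obtain ⟨c, hc, hcJ, hid, hout⟩ := DiffDichotomy.exists_retraction hJ
  obtain ⟨S, U, hSU⟩ := hA.exists_extension hc hcJ hid hout
  obtain ⟨b, hb, hcb, hβ, hβb, hL, hL1⟩ :=
    DiffDichotomy.exists_optimal_exponent hA.one_le hA.pos hδ0 hδ
  obtain ⟨Q, hQ, hrank, hcomm, hbij, hst, hun, hQP⟩ := hSU.exists_perturbed_projection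
    (B := fun k => if k ∈ DiffDichotomy.equationDomain J then B k else 0) (δ := δ) hA.pos
    (fun k => by split_ifs with hk; exacts [hB k hk, by simpa using hδ0])
    (by rw [DiffDichotomy.rho] at hδ; linarith) hb hcb hβ hβb hL
  set C : ℤ → E →L[ℝ] E := fun k => (if k ∈ DiffDichotomy.equationDomain J then A k else
    Real.exp (-α) • P (c k) + Real.exp α • (1 - P (c k))) *
    (1 + if k ∈ DiffDichotomy.equationDomain J then B k else 0) with hC
  have hCA : ∀ k ∈ DiffDichotomy.equationDomain J, C k = A k * (1 + B k) := fun k hk => by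
    simp only [hC, if_pos hk]
  have htr : ∀ m ∈ J, ∀ k ∈ J, m ≤ k →
      DiffDichotomy.transition (fun k => A k * (1 + B k)) k m = DiffDichotomy.transition C k m :=
    fun m hm k hk hmk => DiffDichotomy.transition_congr hmk fun j h1 h2 =>
      (hCA j ⟨hconn.out hm hk ⟨h1, h2.le⟩, hconn.out hm hk ⟨by omega, by omega⟩⟩).symm
  have hbij' : ∀ k ∈ DiffDichotomy.equationDomain J,
      Set.BijOn (⇑(A k * (1 + B k))) (Q k).ker (Q (k + 1)).ker := fun k hk => by
    have := hbij k
    rwa [if_pos hk, if_pos hk] at this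
  have hker : ∀ m k, m ≤ k → DiffDichotomy.expKernel (DiffDichotomy.beta K α δ) (k - m) =
      Real.exp (-DiffDichotomy.beta K α δ * ((k : ℝ) - m)) := fun m k hmk => by
    rw [DiffDichotomy.expKernel_of_nonneg _ (by omega)]
    push_cast
    rfl
  refine ⟨Q, ⟨hL1, hβ, fun k _ => hQ k, fun k _ => ?_, fun m hm k hk hmk => ?_, hbij',
    fun m hm k hk hmk => ?_, fun m hm k hk hmk => ?_⟩, fun k hk => ?_⟩
  · rw [hrank]
    exact hA.rank _ (hcJ k)
  · rw [htr m hm k hk hmk]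
    exact DiffDichotomy.transition_mul_comm hcomm hmk
  · rw [htr m hm k hk hmk, ← hker m k hmk]
    exact hst m k hmk
  · rw [← hker m k hmk]
    refine ContinuousLinearMap.opNorm_le_bound _ (mul_nonneg (zero_le_one.trans hL1)
      (DiffDichotomy.expKernel_pos _ _).le) fun ξ => ?_
    have hs := DiffDichotomy.backwardOperator_spec (hQ k)
      (DiffDichotomy.transition_bijOn hbij' hm hk hmk) ξ
    exact hun m k hmk ξ _ hs.1 (by rw [← hs.2, htr m hm k hk hmk])
  · have := hQP k
    rwa [hid k hk] at this
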